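/- \textbf{Setting.} Let $\{\mathcal K_i\}_{i=1}^{N}$ be a partition of the classes $\{1,\dots,d\}$ into non-empty sets (class $k\in\mathcal K_i$ is served at station $i$), let $\beta_k>0$ be service rates, and let $R=(R_{kl})$ be a non-negative matrix with row sums at most $1$ such that $\sum_n R^n$ converges; put $R_{k0}=1-\sum_l R_{kl}$. A configuration is $\xi=[p_1,\dots,p_N]\in\mathbb X$, where the queue $p_i$ is a finite, possibly empty, sequence of elements of $\mathcal K_i$; the empty configuration is denoted $\emptyset$. Every station has a protocol consisting of (i) insertion operators $I_k$, $k\in\mathcal K_i$, with $I_k(\emptyset)=(k)$, and for $p\ne\emptyset$: $I_k(p)=(p',k,p'')$ for some decomposition $p=(p',p'')$ with $p'\neq\emptyset$ and $k$ not occurring in $p''$; (ii) a service allocation $W_k(p)\ge 0$ with $W_k(p)=0$ if $k$ does not occur in $p$, and $\sum_{k\in\mathcal K_i}W_k(p)=1$ if $p\neq\emptyset$. For $k\in\mathcal K_i$ put $W_k(\xi)=W_k(p_i)$; let $f_{(0,k)}$ apply $I_k$ to $p_i$, let $f_{(k,0)}$ delete the first $k$ (if any) from $p_i$, and let $f_{(k,l)}=f_{(0,l)}\circ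 f_{(k,0)}$. For arrival rates $\theta\in[0,\infty)^d$ the Q-process is the continuous-time Markov chain $(X_t)$ on $\mathbb X$ with generator $$A_\theta\phi=\sum_{k=1}^d\theta_k\,(\phi\circ f_{(0,k)}-\phi)+\sum_{k=1}^d\sum_{l=0}^dW_k\beta_kR_{kl}\,(\phi\circ f_{(k,l)}-\phi).$$ Its transition operators are $P_\theta^t=\exp(tA_\theta)$ on bounded functions. A limiting distribution is a probability measure $\pi_\theta$ on $\mathbb X$ such that $P^t_\theta\psi(\xi)\to\langle\pi_\theta,\psi\rangle:=\int\psi\,d\pi_\theta$ as $t\to\infty$ for every bounded $\psi$ and every $\xi\in\mathbb X$. Let $\Theta=\{\theta\ge 0:\ (I-R^{\mathsf T})^{-1}\theta>0\text{ componentwise}\}$. The stability region $\Theta_{\rm s}$ is the set of all $\theta\in\Theta$ for which the process is ergodic, i.e. has a limiting distribution. Write $\xi\subseteq\zeta$ if every queue of $\xi$ is a (not necessarily contiguous) subsequence of the corresponding queue of $\zeta$. A function $\phi:\mathbb X\to\mathbb R$ is increasing if $\xi\subseteq\zeta$ implies $\phi(\xi)\le\phi(\zeta)$. For a class $\mathcal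 F$ of increasing functions, the Q-process with rates $\theta$ is $\mathcal F$-monotone if, for some $\lambda\ge\|A_\theta\|:=\sum_k\theta_k+\sum_i\max_{k\in\mathcal K_i}\beta_k$, the function $(I+\lambda^{-1}A_\theta)^n\phi$ is increasing for all $\phi\in\mathcal F$ and $n\ge 0$. \textbf{Proposition.} Let $0\le\theta\le\vartheta$ componentwise with $\theta\ne\vartheta$, let $\vartheta\in\Theta_{\rm s}$, and suppose that the process with rates $\theta$ also has a limiting distribution $\pi_\theta$. Let the Q-process with rates $\vartheta$ be $\mathcal F$-monotone, and let $\phi\in\mathcal F$ be bounded and such that for every class $k$ the function $\phi\circ f_{(0,k)}-\phi$ is not identically zero on the set of configurations that the process with rates $\theta$ can reach from $\emptyset$ (this set is all of $\mathbb X$ when that process is irreducible). Then $$\langle\pi_\vartheta,\phi\rangle-\langle\pi_\theta,\phi\rangle>0 .$$ -/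

import Mathlib

open Filter Topology MeasureTheory
open scoped Matrix

noncomputable section

/-- A server protocol on the finite set of classes `K`: a queue policy together with a service
allocation. A queue is a finite list of classes whose first entry is the head of the queue. -/
structure ServerProtocol (K : Type) [Fintype K] [DecidableEq K] where
  /-- `ins k p` is the queue after a job of class `k` joins the queue `p`. -/
  ins : K → List K → List K
  ins_nil : ∀ k, ins k [] = [k]
  /-- The new job overtakes a final segment `p''` of the queue that contains no job of its own
  class, and it never overtakes the head of the queue. -/
  ins_spec : ∀ k p, p ≠ [] → ∃ p' p'' : List K,
    p = p' ++ p'' ∧ p' ≠ [] ∧ k ∉ p'' ∧ ins k p = p' ++ k :: p''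
  /-- `alloc p k` is the fraction of the service capacity given to class `k` in the queue `p`. -/
  alloc : List K → K → ℝ
  alloc_nil : ∀ k, alloc [] k = 0
  alloc_nonneg : ∀ p k, 0 ≤ alloc p k
  alloc_sum : ∀ p, p ≠ [] → ∑ k, alloc p k = 1
  alloc_eq_zero : ∀ p k, k ∉ p → alloc p k = 0

/-- The data of a multi-class queueing network with `d` classes and `N` stations, except for the
arrival rates: assignment of classes to stations, protocols of the stations, service rates
and routing matrix. -/
structure QNetwork (d N : ℕ) where
  /-- The station that serves a class. -/
  srv : Fin d → Fin N
  srv_surjective : Function.Surjective srv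
  protocol : ∀ i : Fin N, ServerProtocol {k : Fin d // srv k = i}
  /-- The service rates. -/
  β : Fin d → ℝ
  β_pos : ∀ k, 0 < β k
  /-- The routing matrix. -/
  R : Matrix (Fin d) (Fin d) ℝ
  R_nonneg : ∀ k l, 0 ≤ R k l
  R_sum_le_one : ∀ k, ∑ l, R k l ≤ 1
  R_transient : Summable fun n : ℕ => R ^ n

namespace QNetwork

variable {d N : ℕ} (net : QNetwork d N)

/-- Configurations of the network: one queue for each station. -/
def State : Type := (i : Fin N) → List {k : Fin d // net.srv k = i}

instance : MeasurableSpace net.State := ⊤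

/-- The empty configuration. -/
def empty : net.State := fun _ => []

/-- The map `f_(0,k)`: arrival of a job of class `k`. -/
def arrive (k : Fin d) (ξ : net.State) : net.State :=
  Function.update ξ (net.srv k) ((net.protocol (net.srv k)).ins ⟨k, rfl⟩ (ξ (net.srv k)))

/-- The map `f_(k,0)`: removal of the first job of class `k`, if there is one. -/
def depart (k : Fin d) (ξ : net.State) : net.State :=
  Function.update ξ (net.srv k) ((ξ (net.srv k)).erase ⟨k, rfl⟩)

/-- The map `f_(k,l)`: the first job of class `k` becomes a job of class `l`. -/
def move (k l : Fin d) (ξ : net.State) : net.State := net.arrive l (net.depart k ξ)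

/-- The fraction of service `W_k(ξ)` that class `k` receives in the configuration `ξ`. -/
def W (k : Fin d) (ξ : net.State) : ℝ :=
  (net.protocol (net.srv k)).alloc (ξ (net.srv k)) ⟨k, rfl⟩

/-- The probability `R_{k0}` that a served job of class `k` leaves the network. -/
def exitProb (k : Fin d) : ℝ := 1 - ∑ l, net.R k l

/-- The generator `A` of the Q-process with arrival rates `θ`, acting on all real functions of the
configuration. -/
def generator (θ : Fin d → ℝ) : Module.End ℝ (net.State → ℝ) where
  toFun φ ξ :=
    ∑ k, θ k * (φ (net.arrive k ξ) - φ ξ)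
      + ∑ k, net.W k ξ * net.β k * net.exitProb k * (φ (net.depart k ξ) - φ ξ)
      + ∑ k, ∑ l, net.W k ξ * net.β k * net.R k l * (φ (net.move k l ξ) - φ ξ)
  map_add' φ ψ := by
    funext ξ
    simp only [Pi.add_apply, add_sub_add_comm, mul_add, Finset.sum_add_distrib]
    ring
  map_smul' c φ := by
    funext ξ
    simp only [Pi.smul_apply, smul_eq_mul, RingHom.id_apply, mul_add, Finset.mul_sum]
    congr 1
    · congr 1
      · exact Finset.sum_congr rfl fun _ _ => by ring
      · exact Finset.sum_congr rfl fun _ _ => by ring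
    · exact Finset.sum_congr rfl fun _ _ => Finset.sum_congr rfl fun _ _ => by ring

/-- The transition operator `P^t = exp(t A)` of the Q-process: `transition θ t φ ξ` is the
expectation of `φ (X_t)` for the process started in `ξ`. It is used for bounded `φ`, where the
exponential series converges absolutely. -/
def transition (θ : Fin d → ℝ) (t : ℝ) (φ : net.State → ℝ) (ξ : net.State) : ℝ :=
  ∑' n : ℕ, t ^ n / (n.factorial : ℝ) * ((net.generator θ ^ n) φ) ξ

/-- The total rate `‖A‖ = ‖θ‖ + ∑ i, max {β k | k at station i}`. -/
def totalRate (θ : Fin d → ℝ) : ℝ :=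
  ∑ k, θ k + ∑ i : Fin N, ⨆ k : {k : Fin d // net.srv k = i}, net.β k

/-- The operator `Q = I + (1/r) A` of the chain embedded at rate `r`. -/
def embedded (θ : Fin d → ℝ) (r : ℝ) : Module.End ℝ (net.State → ℝ) :=
  1 + (1 / r) • net.generator θ

/-- The partial ordering of configurations: at every station, the first queue is a (not necessarily
contiguous) subsequence of the second one. -/
def Sub (ξ ζ : net.State) : Prop := ∀ i, List.Sublist (ξ i) (ζ i)

/-- The class of increasing functions. -/
def increasing : Set (net.State → ℝ) := {φ | ∀ ξ ζ, net.Sub ξ ζ → φ ξ ≤ φ ζ}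

/-- `F`-monotonicity of the Q-process with arrival rates `θ`. -/
def IsMonotone (θ : Fin d → ℝ) (F : Set (net.State → ℝ)) : Prop :=
  ∃ r : ℝ, net.totalRate θ ≤ r ∧
    ∀ φ ∈ F, ∀ n : ℕ, (net.embedded θ r ^ n) φ ∈ net.increasing

/-- The possible transitions of the Q-process with arrival rates `θ`. -/
inductive Step (θ : Fin d → ℝ) : net.State → net.State → Prop
  | arrive (ξ : net.State) (k : Fin d) : 0 < θ k → Step θ ξ (net.arrive k ξ)
  | depart (ξ : net.State) (k : Fin d) :
      0 < net.W k ξ * net.β k * net.exitProb k → Step θ ξ (net.depart k ξ)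
  | move (ξ : net.State) (k l : Fin d) :
      0 < net.W k ξ * net.β k * net.R k l → Step θ ξ (net.move k l ξ)

/-- `ξ` can be reached from the empty configuration under the arrival rates `θ`. -/
def Reachable (θ : Fin d → ℝ) (ξ : net.State) : Prop :=
  Relation.ReflTransGen (net.Step θ) net.empty ξ

/-- The parameter space: non-negative arrival rates for which every class has a positive
total (external and internal) arrival rate. -/
def paramSpace : Set (Fin d → ℝ) :=
  {θ | (∀ k, 0 ≤ θ k) ∧ ∀ k, 0 < ((1 - net.Rᵀ)⁻¹ *ᵥ θ) k}

/-- `π` is the limiting (equilibrium) distribution of the Q-process with arrival rates `θ`: a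
probability measure to which `X_t` converges in law, whatever the initial configuration. -/
def IsLimitingDistribution (θ : Fin d → ℝ) (π : Measure net.State) : Prop :=
  IsProbabilityMeasure π ∧
    ∀ ψ : net.State → ℝ, (∃ C : ℝ, ∀ ξ, |ψ ξ| ≤ C) → ∀ ξ : net.State,
      Tendsto (fun t : ℝ => net.transition θ t ψ ξ) atTop (𝓝 (∫ ζ, ψ ζ ∂π))

/-- The stability region: the arrival rates in the parameter space for which the Q-process is
ergodic. On this countable state space in continuous time, this is positive Harris recurrence. -/
def stabilityRegion : Set (Fin d → ℝ) :=
  {θ | θ ∈ net.paramSpace ∧ ∃ π : Measure net.State, net.IsLimitingDistribution θ π}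

end QNetwork

end

noncomputable section
-- Write `Q` for the chain with rates `ϑ` embedded at the rate `r` of the monotonicity hypothesis.
-- Since `πθ` annihilates the generator with rates `θ` (`integral_generator`), only the extra
-- arrivals survive in the mean of `Q ψ - ψ` under `πθ`: it is `1 / r` times the mean of `∑ k, (ϑ k
-- - θ k) * (ψ (arrive k ξ) - ψ ξ)`. This is non-negative for increasing `ψ`. Monotonicity allows `ψ
-- = Q ^ n φ`, so the means of `Q ^ n φ` under `πθ` increase with `n`.
--
-- The first increment is strict: `πθ` charges every state reachable from the empty one
-- (`measure_ne_zero_of_reachable`), and at some such state an arrival with `θ k < ϑ k` raises `φ`.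
--
-- By uniformization, `P^t φ` for the rates `ϑ` is a Poisson mixture of the `Q ^ n φ`. As `t → ∞`
-- the weight of `n = 0` vanishes, so the limit of the `πθ`-means, which is the mean of `φ` under
-- `πϑ`, is at least the `πθ`-mean of `Q φ`, hence greater than that of `φ`.
namespace QNetwork

/-! ### Exponentials of bounded operators and uniformization -/

section ExpSemigroup

variable {E : Type*} [NormedAddCommGroup E] [NormedSpace ℝ E] [CompleteSpace E]

/-- The semigroup `exp (t T)` generated by a bounded operator `T`. -/
def expSemigroup (T : E →L[ℝ] E) (t : ℝ) : E →L[ℝ] E := NormedSpace.exp (t • T)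

lemma hasSum_expSemigroup_apply (T : E →L[ℝ] E) (t : ℝ) (ψ : E) (L : E →L[ℝ] ℝ) :
    HasSum (fun n : ℕ => t ^ n / (n.factorial : ℝ) * L ((T ^ n) ψ))
      (L (expSemigroup T t ψ)) := by
  have h := (L.comp (ContinuousLinearMap.apply ℝ E ψ)).hasSum
    (NormedSpace.exp_series_hasSum_exp' (𝕂 := ℝ) (t • T))
  refine h.congr_fun fun n => ?_
  simp [smul_pow, div_eq_inv_mul, mul_assoc]

lemma hasDerivAt_expSemigroup_apply (T : E →L[ℝ] E) (t : ℝ) (ψ : E) (L : E →L[ℝ] ℝ) :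
    HasDerivAt (fun s => L (expSemigroup T s ψ)) (L (expSemigroup T t (T ψ))) t :=
  (L.comp (ContinuousLinearMap.apply ℝ E ψ)).hasFDerivAt.comp_hasDerivAt t
    (hasDerivAt_exp_smul_const (𝕂 := ℝ) T t)

lemma expSemigroup_smul_sub_one (Q : E →L[ℝ] E) (r t : ℝ) :
    expSemigroup (r • (Q - 1)) t = Real.exp (-(t * r)) • expSemigroup Q (t * r) := by
  have h1 : t • r • (Q - 1) = (t * r) • Q + (-(t * r)) • (1 : E →L[ℝ] E) := by module
  have h2 : NormedSpace.exp ((-(t * r)) • (1 : E →L[ℝ] E)) = Real.exp (-(t * r)) • 1 := by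
    rw [← Algebra.algebraMap_eq_smul_one, ← Algebra.algebraMap_eq_smul_one,
      ← NormedSpace.algebraMap_exp_comm, Real.exp_eq_exp_ℝ]
  let _ : NormedAlgebra ℚ (E →L[ℝ] E) := NormedAlgebra.restrictScalars ℚ ℝ (E →L[ℝ] E)
  rw [expSemigroup, h1, NormedSpace.exp_add_of_commute
    ((Commute.one_right _).smul_right _), h2, mul_smul_comm, mul_one, expSemigroup]

/-- Uniformization: the semigroup is a Poisson mixture of the powers of the embedded chain. -/
lemma hasSum_uniformization (Q : E →L[ℝ] E) (r t : ℝ) (ψ : E) (L : E →L[ℝ] ℝ) :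
    HasSum (fun n : ℕ => Real.exp (-(t * r)) * ((t * r) ^ n / (n.factorial : ℝ)) *
      L ((Q ^ n) ψ)) (L (expSemigroup (r • (Q - 1)) t ψ)) := by
  have h := (hasSum_expSemigroup_apply Q (t * r) ψ L).mul_left (Real.exp (-(t * r)))
  rw [expSemigroup_smul_sub_one]
  simpa [mul_assoc] using h

lemma hasSum_poisson (s c : ℝ) :
    HasSum (fun n : ℕ => Real.exp (-s) * (s ^ n / (n.factorial : ℝ)) * c) c := by
  have h := ((NormedSpace.expSeries_div_hasSum_exp (𝔸 := ℝ) s).mul_left (Real.exp (-s))).mul_right c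
  rwa [← Real.exp_eq_exp_ℝ, ← Real.exp_add, neg_add_cancel, Real.exp_zero, one_mul] at h

omit [CompleteSpace E] in
lemma norm_pow_apply_le {Q : E →L[ℝ] E} (hQ : ‖Q‖ ≤ 1) (n : ℕ) (ψ : E) : ‖(Q ^ n) ψ‖ ≤ ‖ψ‖ := by
  induction n with
  | zero => exact le_rfl
  | succ n ih =>
    rw [pow_succ']
    exact (Q.le_of_opNorm_le hQ _).trans ((one_mul _).trans_le ih)

/-- A Poisson mixture of contractions is a contraction; the signs of `r` and `t` make the weights
non-negative. -/
lemma norm_expSemigroup_apply_le {Q : E →L[ℝ] E} (hQ : ‖Q‖ ≤ 1) {r t : ℝ} (hr : 0 ≤ r)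
    (ht : 0 ≤ t) (ψ : E) : ‖expSemigroup (r • (Q - 1)) t ψ‖ ≤ ‖ψ‖ := by
  have h := (NormedSpace.exp_series_hasSum_exp' (𝕂 := ℝ) ((t * r) • Q))
  have h2 := ((ContinuousLinearMap.apply ℝ E ψ).hasSum h).const_smul (Real.exp (-(t * r)))
  rw [expSemigroup_smul_sub_one]
  refine HasSum.norm_le_of_bounded h2 (hasSum_poisson (t * r) ‖ψ‖) fun n => ?_
  have hp : 0 ≤ (t * r) ^ n / (n.factorial : ℝ) := by positivity
  have he : Real.exp (-(t * r)) • (ContinuousLinearMap.apply ℝ E ψ)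
      (((n.factorial : ℝ)⁻¹) • ((t * r) • Q) ^ n) =
      (Real.exp (-(t * r)) * ((t * r) ^ n / (n.factorial : ℝ))) • (Q ^ n) ψ := by
    simp [smul_pow, div_eq_inv_mul, smul_smul]
  rw [he, norm_smul, Real.norm_of_nonneg (mul_nonneg (Real.exp_pos _).le hp)]
  exact mul_le_mul_of_nonneg_left (norm_pow_apply_le hQ n ψ) (mul_nonneg (Real.exp_pos _).le hp)

end ExpSemigroup

variable {d N : ℕ} (net : QNetwork d N)

/-! ### Bounds on the total jump rate -/

section Rates

lemma W_nonneg (k : Fin d) (ξ : net.State) : 0 ≤ net.W k ξ :=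
  (net.protocol _).alloc_nonneg _ _

lemma exitProb_nonneg (k : Fin d) : 0 ≤ net.exitProb k :=
  sub_nonneg.2 (net.R_sum_le_one k)

lemma iSup_service_rate_nonneg (i : Fin N) : 0 ≤ ⨆ k : {k : Fin d // net.srv k = i}, net.β k :=
  Real.iSup_nonneg fun k => (net.β_pos k).le

lemma sum_le_totalRate (θ : Fin d → ℝ) : ∑ k, θ k ≤ net.totalRate θ :=
  le_add_of_nonneg_right (Finset.sum_nonneg fun i _ => net.iSup_service_rate_nonneg i)

/-- The added 1 gives an admissible positive rate even for a network without classes. -/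
lemma totalRate_add_one_pos {θ : Fin d → ℝ} (hθ : 0 ≤ θ) : 0 < net.totalRate θ + 1 :=
  add_pos_of_nonneg_of_pos
    ((Finset.sum_nonneg fun k _ => hθ k).trans (net.sum_le_totalRate θ)) one_pos

lemma sum_alloc_le_one {K : Type} [Fintype K] [DecidableEq K] (s : ServerProtocol K) (p : List K) :
    ∑ k, s.alloc p k ≤ 1 := by
  by_cases hp : p = []
  · subst hp
    simp [s.alloc_nil]
  · exact (s.alloc_sum p hp).le

lemma sum_service_le (ξ : net.State) :
    ∑ k, net.W k ξ * net.β k ≤ ∑ i : Fin N, ⨆ k : {k : Fin d // net.srv k = i}, net.β k := by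
  rw [← Fintype.sum_fiberwise net.srv]
  refine Finset.sum_le_sum fun i _ => ?_
  have hW : ∀ k : {k : Fin d // net.srv k = i},
      net.W k ξ = (net.protocol i).alloc (ξ i) k := by
    rintro ⟨k, rfl⟩
    rfl
  calc ∑ k : {k : Fin d // net.srv k = i}, net.W k ξ * net.β k
      ≤ ∑ k : {k : Fin d // net.srv k = i}, (net.protocol i).alloc (ξ i) k *
          ⨆ k : {k : Fin d // net.srv k = i}, net.β k := by
        refine Finset.sum_le_sum fun k _ => ?_
        rw [hW k]
        exact mul_le_mul_of_nonneg_left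
          (le_ciSup (f := fun k : {k : Fin d // net.srv k = i} => net.β k)
            (Set.finite_range _).bddAbove k) ((net.protocol i).alloc_nonneg _ _)
    _ ≤ _ := by
        rw [← Finset.sum_mul]
        exact mul_le_of_le_one_left (net.iSup_service_rate_nonneg i) (sum_alloc_le_one _ _)

lemma sum_rates_le_totalRate (θ : Fin d → ℝ) (ξ : net.State) :
    ∑ k, θ k + ∑ k, net.W k ξ * net.β k * net.exitProb k
      + ∑ k, ∑ l, net.W k ξ * net.β k * net.R k l ≤ net.totalRate θ := by
  rw [add_assoc, ← Finset.sum_add_distrib]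
  refine add_le_add_right (le_trans (le_of_eq ?_) (net.sum_service_le ξ)) _
  refine Finset.sum_congr rfl fun k _ => ?_
  rw [← Finset.mul_sum, ← mul_add, exitProb, sub_add_cancel, mul_one]

end Rates

/-! ### The embedded chain as a sup-norm contraction -/

section Embedded

variable {θ : Fin d → ℝ} {r : ℝ}

lemma embedded_apply (ψ : net.State → ℝ) (ξ : net.State) :
    net.embedded θ r ψ ξ = ψ ξ + 1 / r * net.generator θ ψ ξ := rfl

lemma generator_eq (hr : 0 < r) (ψ : net.State → ℝ) :
    net.generator θ ψ = r • (net.embedded θ r ψ - ψ) := by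
  funext ξ
  simp only [Pi.smul_apply, Pi.sub_apply, embedded_apply, smul_eq_mul]
  field_simp
  ring

/-- Each jump raises `ψ` by at most `C - ψ ξ`, and the jump rates sum to at most `r`. Applied to
`-ψ`, the one-sided bound also gives a minimum principle. -/
lemma generator_apply_le (hθ : 0 ≤ θ) (hle : net.totalRate θ ≤ r) {ψ : net.State → ℝ} {C : ℝ}
    (hψ : ∀ ξ, ψ ξ ≤ C) (ξ : net.State) : net.generator θ ψ ξ ≤ r * (C - ψ ξ) := by
  have hC : 0 ≤ C - ψ ξ := sub_nonneg.2 (hψ ξ)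
  refine le_trans ?_ (mul_le_mul_of_nonneg_right
    ((net.sum_rates_le_totalRate θ ξ).trans hle) hC)
  simp only [add_mul, Finset.sum_mul]
  refine add_le_add (add_le_add ?_ ?_) ?_
  · exact Finset.sum_le_sum fun k _ =>
      mul_le_mul_of_nonneg_left (sub_le_sub_right (hψ _) _) (hθ k)
  · exact Finset.sum_le_sum fun k _ =>
      mul_le_mul_of_nonneg_left (sub_le_sub_right (hψ _) _)
        (mul_nonneg (mul_nonneg (net.W_nonneg k ξ) (net.β_pos k).le) (net.exitProb_nonneg k))
  · exact Finset.sum_le_sum fun k _ => Finset.sum_le_sum fun l _ =>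
      mul_le_mul_of_nonneg_left (sub_le_sub_right (hψ _) _)
        (mul_nonneg (mul_nonneg (net.W_nonneg k ξ) (net.β_pos k).le) (net.R_nonneg k l))

lemma embedded_apply_le (hθ : 0 ≤ θ) (hr : 0 < r) (hle : net.totalRate θ ≤ r)
    {ψ : net.State → ℝ} {C : ℝ} (hψ : ∀ ξ, ψ ξ ≤ C) (ξ : net.State) :
    net.embedded θ r ψ ξ ≤ C := by
  have h := mul_le_mul_of_nonneg_left (net.generator_apply_le hθ hle hψ ξ) (one_div_pos.2 hr).le
  rw [← mul_assoc, one_div_mul_cancel hr.ne', one_mul] at h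
  rw [embedded_apply]
  linarith

lemma abs_embedded_apply_le (hθ : 0 ≤ θ) (hr : 0 < r) (hle : net.totalRate θ ≤ r)
    {ψ : net.State → ℝ} {C : ℝ} (hψ : ∀ ξ, |ψ ξ| ≤ C) (ξ : net.State) :
    |net.embedded θ r ψ ξ| ≤ C := by
  refine abs_le'.2 ⟨net.embedded_apply_le hθ hr hle (fun ζ => (abs_le'.1 (hψ ζ)).1) ξ, ?_⟩
  have h := net.embedded_apply_le hθ hr hle (ψ := -ψ) (fun ζ => (abs_le'.1 (hψ ζ)).2) ξ
  rwa [map_neg] at h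

end Embedded

/-! ### The semigroup on the Banach space of bounded functions -/

section Semigroup

/-- In the discrete topology the bounded continuous functions are all bounded functions. -/
instance : TopologicalSpace net.State := ⊥

instance : DiscreteTopology net.State := ⟨rfl⟩

/-- The Banach space of bounded functions of the configuration. -/
abbrev BddFun : Type := BoundedContinuousFunction net.State ℝ

variable {net}

/-- A bounded function of the configuration as an element of the Banach space. -/
def BddFun.mk (ψ : net.State → ℝ) (h : ∃ C : ℝ, ∀ ξ, |ψ ξ| ≤ C) : net.BddFun :=
  BoundedContinuousFunction.ofNormedAddCommGroupDiscrete ψ h.choose h.choose_spec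

@[simp]
lemma BddFun.coe_mk (ψ : net.State → ℝ) (h : ∃ C : ℝ, ∀ ξ, |ψ ξ| ≤ C) :
    ⇑(BddFun.mk ψ h) = ψ := rfl

lemma BddFun.abs_apply_le (ψ : net.BddFun) (ξ : net.State) : |ψ ξ| ≤ ‖ψ‖ :=
  ψ.norm_coe_le_norm ξ

variable (net) {θ : Fin d → ℝ} {r : ℝ}

/-- The embedded chain as a contraction of the space of bounded functions. -/
def embeddedCLM (hθ : 0 ≤ θ) (hr : 0 < r) (hle : net.totalRate θ ≤ r) :
    net.BddFun →L[ℝ] net.BddFun :=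
  LinearMap.mkContinuous
    { toFun := fun ψ => BddFun.mk (net.embedded θ r ψ)
        ⟨‖ψ‖, net.abs_embedded_apply_le hθ hr hle ψ.abs_apply_le⟩
      map_add' := fun ψ χ => by
        ext ξ
        simp
      map_smul' := fun c ψ => by
        ext ξ
        exact congrFun ((net.embedded θ r).map_smul c ψ) ξ }
    1 fun ψ => by
      rw [one_mul]
      exact (BoundedContinuousFunction.norm_le (norm_nonneg _)).2
        (net.abs_embedded_apply_le hθ hr hle ψ.abs_apply_le)

variable (hθ : 0 ≤ θ) (hr : 0 < r) (hle : net.totalRate θ ≤ r)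

lemma norm_embeddedCLM_le : ‖net.embeddedCLM hθ hr hle‖ ≤ 1 :=
  LinearMap.mkContinuous_norm_le _ zero_le_one _

lemma coe_embeddedCLM_pow (n : ℕ) (ψ : net.BddFun) :
    ⇑((net.embeddedCLM hθ hr hle ^ n) ψ) = (net.embedded θ r ^ n) ψ := by
  induction n with
  | zero => rfl
  | succ n ih =>
    rw [pow_succ', pow_succ', mul_apply_eq_comp, Module.End.mul_apply, ← ih]
    rfl

/-- The generator as a bounded operator on the space of bounded functions. -/
def generatorCLM : net.BddFun →L[ℝ] net.BddFun := r • (net.embeddedCLM hθ hr hle - 1)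

lemma coe_generatorCLM (ψ : net.BddFun) :
    ⇑(net.generatorCLM hθ hr hle ψ) = net.generator θ ψ := by
  rw [net.generator_eq hr]
  rfl

lemma coe_generatorCLM_pow (n : ℕ) (ψ : net.BddFun) :
    ⇑((net.generatorCLM hθ hr hle ^ n) ψ) = (net.generator θ ^ n) ψ := by
  induction n with
  | zero => rfl
  | succ n ih =>
    rw [pow_succ', pow_succ', mul_apply_eq_comp, Module.End.mul_apply, ← ih,
      coe_generatorCLM]

/-- Evaluation at `ξ` is a continuous functional, so it passes through the exponential series. -/
lemma transition_eq (hθ : 0 ≤ θ) (hr : 0 < r) (hle : net.totalRate θ ≤ r)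
    (t : ℝ) (ψ : net.BddFun) (ξ : net.State) :
    net.transition θ t ψ ξ = expSemigroup (net.generatorCLM hθ hr hle) t ψ ξ := by
  have h := hasSum_expSemigroup_apply (net.generatorCLM hθ hr hle) t ψ
    (BoundedContinuousFunction.evalCLM ℝ ξ)
  simp only [BoundedContinuousFunction.evalCLM_apply, coe_generatorCLM_pow] at h
  exact h.tsum_eq

lemma abs_transition_le (hθ : 0 ≤ θ) {t : ℝ} (ht : 0 ≤ t) (ψ : net.BddFun) (ξ : net.State) :
    |net.transition θ t ψ ξ| ≤ ‖ψ‖ := by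
  have hr : 0 < net.totalRate θ + 1 := net.totalRate_add_one_pos hθ
  have hle : net.totalRate θ ≤ net.totalRate θ + 1 := le_add_of_nonneg_right zero_le_one
  rw [net.transition_eq hθ hr hle]
  exact (BoundedContinuousFunction.norm_coe_le_norm _ ξ).trans
    (norm_expSemigroup_apply_le (net.norm_embeddedCLM_le hθ hr hle) hr.le ht ψ)

lemma hasDerivAt_transition (hθ : 0 ≤ θ) (t : ℝ) (ψ : net.BddFun) (ξ : net.State) :
    HasDerivAt (fun s => net.transition θ s ψ ξ)
      (net.transition θ t (net.generator θ ψ) ξ) t := by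
  have hr : 0 < net.totalRate θ + 1 := net.totalRate_add_one_pos hθ
  have hle : net.totalRate θ ≤ net.totalRate θ + 1 := le_add_of_nonneg_right zero_le_one
  have h := hasDerivAt_expSemigroup_apply (net.generatorCLM hθ hr hle) t ψ
    (BoundedContinuousFunction.evalCLM ℝ ξ)
  rw [← net.coe_generatorCLM hθ hr hle ψ, net.transition_eq hθ hr hle]
  refine h.congr_of_eventuallyEq (Eventually.of_forall fun s => ?_)
  exact net.transition_eq hθ hr hle s ψ ξ

end Semigroup

/-! ### Limiting distributions annihilate the generator -/

section Invariance

instance : Countable net.State :=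
  inferInstanceAs (Countable ((i : Fin N) → List {k : Fin d // net.srv k = i}))

instance : DiscreteMeasurableSpace net.State := ⟨fun _ => trivial⟩

variable {net}

lemma BddFun.integrable (π : Measure net.State) [IsFiniteMeasure π] (ψ : net.BddFun) :
    Integrable ψ π :=
  Integrable.of_bound (Measurable.of_discrete (f := ψ)).aestronglyMeasurable ‖ψ‖
    (ae_of_all _ ψ.norm_coe_le_norm)

/-- A limit of the derivative at infinity vanishes if the function itself converges. -/
lemma eq_zero_of_tendsto_of_hasDerivAt {f f' : ℝ → ℝ} {a b : ℝ}
    (hf : ∀ t, HasDerivAt f (f' t) t) (ha : Tendsto f atTop (𝓝 a))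
    (hb : Tendsto f' atTop (𝓝 b)) : b = 0 := by
  -- The mean value theorem on `[n, n + 1]` evaluates `f'` along a sequence tending to infinity.
  have hmean : ∀ n : ℕ, ∃ c : ℝ, (n : ℝ) ≤ c ∧ f' c = f (n + 1) - f n := fun n => by
    obtain ⟨c, hc, h⟩ := exists_hasDerivAt_eq_slope f f' (lt_add_one (n : ℝ))
      (fun t _ => (hf t).continuousAt.continuousWithinAt) fun t _ => hf t
    exact ⟨c, hc.1.le, by rw [h, add_sub_cancel_left, div_one]⟩
  choose c hc hfc using hmean
  have h1 : Tendsto (fun n => f' (c n)) atTop (𝓝 b) :=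
    hb.comp (tendsto_atTop_mono hc tendsto_natCast_atTop_atTop)
  have h2 : Tendsto (fun n : ℕ => f (n + 1) - f n) atTop (𝓝 (a - a)) :=
    (ha.comp (tendsto_atTop_add_const_right _ 1 tendsto_natCast_atTop_atTop)).sub
      (ha.comp tendsto_natCast_atTop_atTop)
  rw [sub_self] at h2
  exact tendsto_nhds_unique h1 (h2.congr fun n => (hfc n).symm)

/-- The function `t ↦ P^t ψ` at the empty state has derivative `P^t (A ψ)`, and both converge as `t
→ ∞`. -/
lemma IsLimitingDistribution.integral_generator {θ : Fin d → ℝ} (hθ : 0 ≤ θ)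
    {π : Measure net.State} (hπ : net.IsLimitingDistribution θ π) (ψ : net.BddFun) :
    ∫ ξ, net.generator θ ψ ξ ∂π = 0 := by
  have hr : 0 < net.totalRate θ + 1 := net.totalRate_add_one_pos hθ
  have hle : net.totalRate θ ≤ net.totalRate θ + 1 := le_add_of_nonneg_right zero_le_one
  refine eq_zero_of_tendsto_of_hasDerivAt
    (fun t => net.hasDerivAt_transition hθ t ψ net.empty)
    (hπ.2 ψ ⟨_, ψ.abs_apply_le⟩ net.empty) (hπ.2 _ ⟨‖net.generatorCLM hθ hr hle ψ‖, ?_⟩ net.empty)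
  rw [← net.coe_generatorCLM hθ hr hle ψ]
  exact BddFun.abs_apply_le _

end Invariance

/-! ### The support of a limiting distribution is closed under transitions -/

section Support

variable {θ : Fin d → ℝ}

lemma generator_apply_nonneg (hθ : 0 ≤ θ) {ψ : net.State → ℝ} (hψ : ∀ ξ, 0 ≤ ψ ξ)
    {ζ : net.State} (hζ : ψ ζ = 0) : 0 ≤ net.generator θ ψ ζ := by
  have h := net.generator_apply_le (r := net.totalRate θ) hθ le_rfl (ψ := -ψ) (C := 0)
    (fun ξ => neg_nonpos.2 (hψ ξ)) ζ
  rw [map_neg] at h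
  simpa [hζ] using h

lemma generator_apply_pos (hθ : 0 ≤ θ) {ψ : net.State → ℝ} (hψ : ∀ ξ, 0 ≤ ψ ξ)
    {ζ ξ : net.State} (hζ : ψ ζ = 0) (hξ : 0 < ψ ξ) (h : net.Step θ ζ ξ) :
    0 < net.generator θ ψ ζ := by
  have hβ : ∀ k, 0 ≤ net.W k ζ * net.β k := fun k =>
    mul_nonneg (net.W_nonneg k ζ) (net.β_pos k).le
  have ha : ∀ k, 0 ≤ θ k * (ψ (net.arrive k ζ) - ψ ζ) := fun k =>
    mul_nonneg (hθ k) (by rw [hζ, sub_zero]; exact hψ _)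
  have hd : ∀ k, 0 ≤ net.W k ζ * net.β k * net.exitProb k * (ψ (net.depart k ζ) - ψ ζ) :=
    fun k => mul_nonneg (mul_nonneg (hβ k) (net.exitProb_nonneg k))
      (by rw [hζ, sub_zero]; exact hψ _)
  have hm : ∀ k l, 0 ≤ net.W k ζ * net.β k * net.R k l * (ψ (net.move k l ζ) - ψ ζ) :=
    fun k l => mul_nonneg (mul_nonneg (hβ k) (net.R_nonneg k l))
      (by rw [hζ, sub_zero]; exact hψ _)
  have sa := Finset.sum_nonneg fun k (_ : k ∈ Finset.univ) => ha k
  have sd := Finset.sum_nonneg fun k (_ : k ∈ Finset.univ) => hd k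
  have sm := Finset.sum_nonneg fun k (_ : k ∈ Finset.univ) =>
    Finset.sum_nonneg fun l (_ : l ∈ Finset.univ) => hm k l
  cases h with
  | arrive k hk =>
    refine add_pos_of_pos_of_nonneg (add_pos_of_pos_of_nonneg ?_ sd) sm
    exact Finset.sum_pos' (fun k _ => ha k)
      ⟨k, Finset.mem_univ _, mul_pos hk (by rwa [hζ, sub_zero])⟩
  | depart k hk =>
    refine add_pos_of_pos_of_nonneg (add_pos_of_nonneg_of_pos sa ?_) sm
    exact Finset.sum_pos' (fun k _ => hd k)
      ⟨k, Finset.mem_univ _, mul_pos hk (by rwa [hζ, sub_zero])⟩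
  | move k l hk =>
    refine add_pos_of_nonneg_of_pos (add_nonneg sa sd) ?_
    exact Finset.sum_pos' (fun k _ => Finset.sum_nonneg fun l _ => hm k l)
      ⟨k, Finset.mem_univ _, Finset.sum_pos' (fun l _ => hm k l)
        ⟨l, Finset.mem_univ _, mul_pos hk (by rwa [hζ, sub_zero])⟩⟩

variable {net} {π : Measure net.State}

lemma eq_zero_of_ae_eq_zero {f : net.State → ℝ} (h : f =ᵐ[π] 0) {η : net.State}
    (hη : π {η} ≠ 0) : f η = 0 := by
  by_contra hf
  exact hη (measure_mono_null (Set.singleton_subset_iff.2 hf) h)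

/-- Let `ψ` be the indicator of `ξ`. If `ξ` were a null state, `A ψ` would be non-negative almost
everywhere with integral zero, hence zero at the charged state `η`; but the step from `η` to `ξ`
makes it positive there. -/
lemma IsLimitingDistribution.measure_ne_zero_of_step (hθ : 0 ≤ θ)
    (hπ : net.IsLimitingDistribution θ π) {η ξ : net.State} (hη : π {η} ≠ 0)
    (h : net.Step θ η ξ) : π {ξ} ≠ 0 := by
  intro hξ
  have hr : 0 < net.totalRate θ + 1 := net.totalRate_add_one_pos hθ
  have hle : net.totalRate θ ≤ net.totalRate θ + 1 := le_add_of_nonneg_right zero_le_one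
  have := hπ.1
  let ψ : net.BddFun := BddFun.mk (Set.indicator {ξ} 1) ⟨1, fun ζ => by
    by_cases hζ : ζ = ξ <;> simp [hζ]⟩
  have hψ0 : ∀ ζ, 0 ≤ ψ ζ := Set.indicator_nonneg fun _ _ => zero_le_one
  have hψ : ∀ ζ, ζ ≠ ξ → ψ ζ = 0 := fun ζ hζ => Set.indicator_of_notMem (s := {ξ}) hζ 1
  have hψξ : ψ ξ = 1 := Set.indicator_of_mem (s := {ξ}) rfl 1
  have hnonneg : 0 ≤ᵐ[π] net.generator θ ψ := by
    have : ∀ᵐ ζ ∂π, ζ ≠ ξ := by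
      rw [ae_iff]
      simpa using hξ
    filter_upwards [this] with ζ hζ
    exact net.generator_apply_nonneg hθ hψ0 (hψ ζ hζ)
  have hint : Integrable (net.generator θ ψ) π := by
    rw [← net.coe_generatorCLM hθ hr hle]
    exact BddFun.integrable π _
  have hzero := (integral_eq_zero_iff_of_nonneg_ae hnonneg hint).1 (hπ.integral_generator hθ ψ)
  have hηξ : η ≠ ξ := fun he => hη (he ▸ hξ)
  exact (net.generator_apply_pos hθ hψ0 (hψ η hηξ) (hψξ ▸ one_pos) h).ne'
    (eq_zero_of_ae_eq_zero hzero hη)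

lemma IsLimitingDistribution.measure_ne_zero_of_reflTransGen (hθ : 0 ≤ θ)
    (hπ : net.IsLimitingDistribution θ π) {η ξ : net.State} (hη : π {η} ≠ 0)
    (h : Relation.ReflTransGen (net.Step θ) η ξ) : π {ξ} ≠ 0 := by
  induction h with
  | refl => exact hη
  | tail _ h ih => exact hπ.measure_ne_zero_of_step hθ ih h

lemma exists_measure_singleton_ne_zero (π : Measure net.State) [IsProbabilityMeasure π] :
    ∃ η, π {η} ≠ 0 := by
  by_contra! h
  refine one_ne_zero (α := ENNReal) ?_
  rw [← measure_univ (μ := π), ← Set.iUnion_of_singleton net.State]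
  exact measure_iUnion_null h

end Support

/-! ### Every configuration can be emptied -/

section Drain

/-- The expected number of services that a job of class `k` receives before it leaves. -/
def workload (k : Fin d) : ℝ := ((∑' n : ℕ, net.R ^ n) *ᵥ 1) k

lemma workload_eq (k : Fin d) : net.workload k = 1 + ∑ l, net.R k l * net.workload l := by
  have h : ∑' n : ℕ, net.R ^ n = 1 + net.R * ∑' n : ℕ, net.R ^ n := by
    conv_lhs => rw [net.R_transient.tsum_eq_zero_add, pow_zero]
    rw [← net.R_transient.tsum_mul_left]
    simp only [pow_succ']
  calc net.workload k = ((1 + net.R * ∑' n : ℕ, net.R ^ n) *ᵥ 1) k := by rw [← h]; rfl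
    _ = _ := by
      rw [Matrix.add_mulVec, Matrix.one_mulVec, ← Matrix.mulVec_mulVec]
      rfl

lemma workload_nonneg (k : Fin d) : 0 ≤ net.workload k := by
  have hpow : ∀ n k l, 0 ≤ (net.R ^ n) k l := fun n => by
    induction n with
    | zero =>
      intro k l
      rw [pow_zero, Matrix.one_apply]
      positivity
    | succ n ih =>
      intro k l
      rw [pow_succ, Matrix.mul_apply]
      exact Finset.sum_nonneg fun j _ => mul_nonneg (ih k j) (net.R_nonneg j l)
  unfold workload Matrix.mulVec dotProduct
  refine Finset.sum_nonneg fun l _ => mul_nonneg ?_ (zero_le_one (α := ℝ))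
  have h : HasSum (fun n => (net.R ^ n) k l) ((∑' n : ℕ, net.R ^ n) k l) :=
    Pi.hasSum.1 (Pi.hasSum.1 net.R_transient.hasSum k) l
  exact h.nonneg fun n => hpow n k l

lemma one_le_workload (k : Fin d) : 1 ≤ net.workload k := by
  rw [workload_eq]
  exact le_add_of_nonneg_right
    (Finset.sum_nonneg fun l _ => mul_nonneg (net.R_nonneg k l) (net.workload_nonneg l))

/-- Without exit, row `k` of `R` is a probability vector, and `workload_eq` makes the average
workload of the next class equal to `workload k - 1`. Some possible next class does not exceed this
average. -/
lemma exitProb_pos_or_exists_workload_le (k : Fin d) :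
    0 < net.exitProb k ∨ ∃ l, 0 < net.R k l ∧ net.workload l + 1 ≤ net.workload k := by
  by_contra! h
  obtain ⟨h0, hl⟩ := h
  have h1 : ∑ l, net.R k l = 1 :=
    le_antisymm (net.R_sum_le_one k) (sub_nonpos.1 h0)
  obtain ⟨l, -, hpos⟩ : ∃ l ∈ Finset.univ, 0 < net.R k l :=
    Finset.exists_lt_of_sum_lt (f := fun _ => (0 : ℝ)) (by simp [h1])
  have h2 : ∑ l, net.R k l * (net.workload k - 1) < ∑ l, net.R k l * net.workload l := by
    refine Finset.sum_lt_sum (fun j _ => ?_) ⟨l, Finset.mem_univ l, ?_⟩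
    · rcases (net.R_nonneg k j).eq_or_lt with hj | hj
      · rw [← hj, zero_mul, zero_mul]
      · exact mul_le_mul_of_nonneg_left (by linarith [hl j hj]) hj.le
    · exact mul_lt_mul_of_pos_left (by linarith [hl l hpos]) hpos
  rw [← Finset.sum_mul, h1] at h2
  linarith [net.workload_eq k]

/-- The workload of a queue. -/
def queueLoad {i : Fin N} (p : List {k : Fin d // net.srv k = i}) : ℝ :=
  (p.map fun k : {k : Fin d // net.srv k = i} => net.workload k).sum

/-- The total workload of a configuration. -/
def load (ξ : net.State) : ℝ := ∑ i, net.queueLoad (ξ i)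

lemma queueLoad_nonneg {i : Fin N} (p : List {k : Fin d // net.srv k = i}) :
    0 ≤ net.queueLoad p := by
  refine List.sum_nonneg fun x hx => ?_
  obtain ⟨k, -, rfl⟩ := List.mem_map.1 hx
  exact net.workload_nonneg k

lemma load_nonneg (ξ : net.State) : 0 ≤ net.load ξ :=
  Finset.sum_nonneg fun i _ => net.queueLoad_nonneg (ξ i)

lemma queueLoad_eq_of_perm_cons {i : Fin N} {p q : List {k : Fin d // net.srv k = i}}
    {k : {k : Fin d // net.srv k = i}} (h : q.Perm (k :: p)) :
    net.queueLoad q = net.workload k + net.queueLoad p := by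
  rw [queueLoad, (h.map _).sum_eq]
  rfl

lemma load_eq_of_eq_off {ξ ζ : net.State} {i : Fin N} (h : ∀ j, j ≠ i → ζ j = ξ j) :
    net.load ζ = net.load ξ + (net.queueLoad (ζ i) - net.queueLoad (ξ i)) := by
  rw [load, load, ← Finset.add_sum_erase _ _ (Finset.mem_univ i),
    ← Finset.add_sum_erase _ (fun i => net.queueLoad (ξ i)) (Finset.mem_univ i),
    Finset.sum_congr rfl fun j hj => congrArg net.queueLoad (h j (Finset.ne_of_mem_erase hj))]
  ring

lemma arrive_apply_self (k : Fin d) (ξ : net.State) :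
    net.arrive k ξ (net.srv k) =
      (net.protocol (net.srv k)).ins ⟨k, rfl⟩ (ξ (net.srv k)) :=
  Function.update_self ..

lemma arrive_apply_of_ne (k : Fin d) (ξ : net.State) {i : Fin N} (hi : i ≠ net.srv k) :
    net.arrive k ξ i = ξ i :=
  Function.update_of_ne hi ..

lemma depart_apply_self (k : Fin d) (ξ : net.State) :
    net.depart k ξ (net.srv k) = (ξ (net.srv k)).erase ⟨k, rfl⟩ :=
  Function.update_self ..

lemma depart_apply_of_ne (k : Fin d) (ξ : net.State) {i : Fin N} (hi : i ≠ net.srv k) :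
    net.depart k ξ i = ξ i :=
  Function.update_of_ne hi ..

lemma ins_perm {K : Type} [Fintype K] [DecidableEq K] (s : ServerProtocol K) (k : K) (p : List K) :
    (s.ins k p).Perm (k :: p) := by
  by_cases hp : p = []
  · rw [hp, s.ins_nil]
  · obtain ⟨p', p'', rfl, -, -, h⟩ := s.ins_spec k p hp
    rw [h]
    exact List.perm_middle

lemma sublist_ins {K : Type} [Fintype K] [DecidableEq K] (s : ServerProtocol K) (k : K)
    (p : List K) : p.Sublist (s.ins k p) := by
  by_cases hp : p = []
  · rw [hp]
    exact List.nil_sublist _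
  · obtain ⟨p', p'', rfl, -, -, h⟩ := s.ins_spec k p hp
    rw [h]
    exact (List.Sublist.refl p').append (List.sublist_cons_self k p'')

lemma load_arrive (k : Fin d) (ξ : net.State) :
    net.load (net.arrive k ξ) = net.load ξ + net.workload k := by
  rw [net.load_eq_of_eq_off fun i => net.arrive_apply_of_ne k ξ, arrive_apply_self,
    net.queueLoad_eq_of_perm_cons (ins_perm _ _ _), add_sub_cancel_right]

lemma load_depart {k : Fin d} {ξ : net.State}
    (h : (⟨k, rfl⟩ : {l : Fin d // net.srv l = net.srv k}) ∈ ξ (net.srv k)) :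
    net.load (net.depart k ξ) = net.load ξ - net.workload k := by
  rw [net.load_eq_of_eq_off fun i => net.depart_apply_of_ne k ξ, depart_apply_self,
    net.queueLoad_eq_of_perm_cons (List.perm_cons_erase h)]
  ring

lemma exists_W_pos {ξ : net.State} (hξ : ξ ≠ net.empty) : ∃ k, 0 < net.W k ξ := by
  obtain ⟨i, hi⟩ := Function.ne_iff.1 hξ
  have h : 0 < ∑ k, (net.protocol i).alloc (ξ i) k := by
    rw [(net.protocol i).alloc_sum _ hi]
    exact one_pos
  obtain ⟨⟨k, rfl⟩, -, hk⟩ : ∃ k ∈ Finset.univ, 0 < (net.protocol i).alloc (ξ i) k :=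
    Finset.exists_lt_of_sum_lt (f := fun _ => (0 : ℝ)) (by simpa using h)
  exact ⟨k, hk⟩

lemma mem_of_W_pos {k : Fin d} {ξ : net.State} (h : 0 < net.W k ξ) :
    (⟨k, rfl⟩ : {l : Fin d // net.srv l = net.srv k}) ∈ ξ (net.srv k) := by
  by_contra hk
  exact h.ne' ((net.protocol _).alloc_eq_zero _ _ hk)

/-- A class in service either leaves, removing a workload of at least 1, or turns into a class whose
workload is smaller by at least 1. -/
lemma exists_step_load_le (θ : Fin d → ℝ) {ξ : net.State} (hξ : ξ ≠ net.empty) :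
    ∃ ζ, net.Step θ ξ ζ ∧ net.load ζ + 1 ≤ net.load ξ := by
  obtain ⟨k, hk⟩ := net.exists_W_pos hξ
  have hβ : 0 < net.W k ξ * net.β k := mul_pos hk (net.β_pos k)
  have hd := net.load_depart (net.mem_of_W_pos hk)
  rcases net.exitProb_pos_or_exists_workload_le k with h | ⟨l, hl, hkl⟩
  · exact ⟨_, .depart ξ k (mul_pos hβ h), by linarith [net.one_le_workload k]⟩
  · refine ⟨_, .move ξ k l (mul_pos hβ hl), ?_⟩
    rw [move, load_arrive]
    linarith

/-- Without further arrivals, the network can be emptied from any configuration. -/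
lemma reflTransGen_step_empty (θ : Fin d → ℝ) (ξ : net.State) :
    Relation.ReflTransGen (net.Step θ) ξ net.empty := by
  -- The load is non-negative and can be lowered by at least 1 per step, so `n` bounds the number of
  -- steps needed.
  obtain ⟨n, hn⟩ := exists_nat_ge (net.load ξ)
  induction n generalizing ξ with
  | zero =>
    by_cases hξ : ξ = net.empty
    · rw [hξ]
    · obtain ⟨ζ, -, hζ⟩ := net.exists_step_load_le θ hξ
      push_cast at hn
      linarith [net.load_nonneg ζ]
  | succ n ih =>
    by_cases hξ : ξ = net.empty
    · rw [hξ]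
    · obtain ⟨ζ, h, hζ⟩ := net.exists_step_load_le θ hξ
      push_cast at hn
      exact .head h (ih ζ (by linarith))

variable {net} in
-- Some state is charged, since the state space is countable; from it the network drains to the
-- empty state and then moves on to `ξ`. Irreducibility is not needed.
lemma IsLimitingDistribution.measure_ne_zero_of_reachable {θ : Fin d → ℝ} (hθ : 0 ≤ θ)
    {π : Measure net.State} (hπ : net.IsLimitingDistribution θ π) {ξ : net.State}
    (h : net.Reachable θ ξ) : π {ξ} ≠ 0 := by
  have := hπ.1
  obtain ⟨η, hη⟩ := exists_measure_singleton_ne_zero π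
  exact hπ.measure_ne_zero_of_reflTransGen hθ hη ((net.reflTransGen_step_empty θ η).trans h)

end Drain

/-! ### Comparing the two arrival rates under the law `π` -/

section Comparison

lemma sub_arrive (k : Fin d) (ξ : net.State) : net.Sub ξ (net.arrive k ξ) := by
  intro i
  by_cases hi : i = net.srv k
  · subst hi
    rw [arrive_apply_self]
    exact sublist_ins _ _ _
  · rw [net.arrive_apply_of_ne k ξ hi]

/-- Changing the arrival rates changes the embedded chain by a combination of the arrival
increments. -/
lemma embedded_apply_eq_add (θ ϑ : Fin d → ℝ) (r : ℝ) (ψ : net.State → ℝ) (ξ : net.State) :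
    net.embedded ϑ r ψ ξ = ψ ξ + 1 / r * net.generator θ ψ ξ
      + 1 / r * ∑ k, (ϑ k - θ k) * (ψ (net.arrive k ξ) - ψ ξ) := by
  have h : net.generator ϑ ψ ξ = net.generator θ ψ ξ
      + ∑ k, (ϑ k - θ k) * (ψ (net.arrive k ξ) - ψ ξ) := by
    simp only [generator, LinearMap.coe_mk, AddHom.coe_mk, sub_mul, Finset.sum_sub_distrib]
    ring
  rw [embedded_apply, h]
  ring

variable {net}

/-- Integration of bounded functions as a continuous linear functional. -/
def integralCLM (π : Measure net.State) [IsProbabilityMeasure π] : net.BddFun →L[ℝ] ℝ :=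
  LinearMap.mkContinuous
    { toFun := fun ψ => ∫ ξ, ψ ξ ∂π
      map_add' := fun ψ χ => integral_add (ψ.integrable π) (χ.integrable π)
      map_smul' := fun c ψ => integral_const_mul c _ }
    1 fun ψ => by
      refine (norm_integral_le_of_norm_le_const (ae_of_all _ ψ.norm_coe_le_norm)).trans ?_
      simp

lemma integralCLM_apply (π : Measure net.State) [IsProbabilityMeasure π] (ψ : net.BddFun) :
    integralCLM π ψ = ∫ ξ, ψ ξ ∂π := rfl

variable {θ ϑ : Fin d → ℝ} {r : ℝ} {π : Measure net.State}

lemma IsLimitingDistribution.integral_embedded_sub (hθ : 0 ≤ θ) (hϑ : 0 ≤ ϑ) (hr : 0 < r)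
    (hle : net.totalRate ϑ ≤ r) (hπ : net.IsLimitingDistribution θ π) (ψ : net.BddFun) :
    Integrable (fun ξ => ∑ k, (ϑ k - θ k) * (ψ (net.arrive k ξ) - ψ ξ)) π ∧
    ∫ ξ, net.embedded ϑ r ψ ξ ∂π - ∫ ξ, ψ ξ ∂π =
      1 / r * ∫ ξ, ∑ k, (ϑ k - θ k) * (ψ (net.arrive k ξ) - ψ ξ) ∂π := by
  have := hπ.1
  have hr' : 0 < net.totalRate θ + 1 := net.totalRate_add_one_pos hθ
  have hle' : net.totalRate θ ≤ net.totalRate θ + 1 := le_add_of_nonneg_right zero_le_one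
  have hg : Integrable (net.generator θ ψ) π := by
    rw [← net.coe_generatorCLM hθ hr' hle']
    exact BddFun.integrable π _
  have he : Integrable (net.embedded ϑ r ψ) π :=
    BddFun.integrable π (net.embeddedCLM hϑ hr hle ψ)
  -- The arrival term is what remains of `Q ψ` after subtracting two integrable functions.
  have hs : Integrable (fun ξ => 1 / r * ∑ k, (ϑ k - θ k) * (ψ (net.arrive k ξ) - ψ ξ)) π := by
    refine ((he.sub (ψ.integrable π)).sub (hg.const_mul (1 / r))).congr (ae_of_all _ fun ξ => ?_)
    simp only [Pi.sub_apply, net.embedded_apply_eq_add θ ϑ]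
    ring
  refine ⟨(integrable_const_mul_iff (one_div_pos.2 hr).ne'.isUnit _).1 hs, ?_⟩
  rw [← integral_const_mul]
  simp only [net.embedded_apply_eq_add θ ϑ]
  have hψg : Integrable (fun ξ => ψ ξ + 1 / r * net.generator θ ψ ξ) π :=
    (ψ.integrable π).add (hg.const_mul _)
  rw [integral_add hψg hs, integral_add (ψ.integrable π) (hg.const_mul _),
    integral_const_mul (1 / r) (net.generator θ ψ), hπ.integral_generator hθ]
  ring

lemma sum_arrive_nonneg (hlt : θ ≤ ϑ) {ψ : net.State → ℝ} (hψ : ψ ∈ net.increasing)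
    (ξ : net.State) : 0 ≤ ∑ k, (ϑ k - θ k) * (ψ (net.arrive k ξ) - ψ ξ) :=
  Finset.sum_nonneg fun k _ =>
    mul_nonneg (sub_nonneg.2 (hlt k)) (sub_nonneg.2 (hψ _ _ (net.sub_arrive k ξ)))

lemma IsLimitingDistribution.integral_le_integral_embedded (hθ : 0 ≤ θ) (hlt : θ ≤ ϑ) (hr : 0 < r)
    (hle : net.totalRate ϑ ≤ r) (hπ : net.IsLimitingDistribution θ π) (ψ : net.BddFun)
    (hψ : ⇑ψ ∈ net.increasing) : ∫ ξ, ψ ξ ∂π ≤ ∫ ξ, net.embedded ϑ r ψ ξ ∂π := by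
  rw [← sub_nonneg, (hπ.integral_embedded_sub hθ (hθ.trans hlt) hr hle ψ).2]
  exact mul_nonneg (one_div_pos.2 hr).le (integral_nonneg fun ξ => sum_arrive_nonneg hlt hψ ξ)

lemma IsLimitingDistribution.integral_lt_integral_embedded (hθ : 0 ≤ θ) (hlt : θ < ϑ) (hr : 0 < r)
    (hle : net.totalRate ϑ ≤ r) (hπ : net.IsLimitingDistribution θ π) (ψ : net.BddFun)
    (hψ : ⇑ψ ∈ net.increasing)
    (hne : ∀ k : Fin d, ∃ ξ, net.Reachable θ ξ ∧ ψ (net.arrive k ξ) ≠ ψ ξ) :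
    ∫ ξ, ψ ξ ∂π < ∫ ξ, net.embedded ϑ r ψ ξ ∂π := by
  obtain ⟨hint, heq⟩ := hπ.integral_embedded_sub hθ (hθ.trans hlt.le) hr hle ψ
  rw [← sub_pos, heq]
  refine mul_pos (one_div_pos.2 hr) ?_
  refine (integral_nonneg fun ξ => sum_arrive_nonneg hlt.le hψ ξ).lt_of_ne fun h0 => ?_
  have hzero := (integral_eq_zero_iff_of_nonneg (fun ξ => sum_arrive_nonneg hlt.le hψ ξ) hint).1 h0.symm
  obtain ⟨k, hk⟩ := (Pi.lt_def.1 hlt).2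
  obtain ⟨ξ, hreach, hξ⟩ := hne k
  -- The sum is positive at `ξ`, a state of positive mass, although it vanishes almost everywhere.
  refine (Finset.sum_pos' (fun l _ => mul_nonneg (sub_nonneg.2 (hlt.le l))
    (sub_nonneg.2 (hψ _ _ (net.sub_arrive l ξ)))) ⟨k, Finset.mem_univ k, mul_pos (sub_pos.2 hk)
      (sub_pos.2 ((hψ _ _ (net.sub_arrive k ξ)).lt_of_ne hξ.symm))⟩).ne' ?_
  exact eq_zero_of_ae_eq_zero hzero (hπ.measure_ne_zero_of_reachable hθ hreach)

/-- The mean of `P^t ψ` under a law for which the means of `Q^n ψ` increase in `n`. -/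
lemma le_integral_transition (hϑ : 0 ≤ ϑ) (hr : 0 < r) (hle : net.totalRate ϑ ≤ r)
    [IsProbabilityMeasure π] (ψ : net.BddFun)
    (hmono : Monotone fun n : ℕ => ∫ ξ, (net.embedded ϑ r ^ n) ψ ξ ∂π) {t : ℝ} (ht : 0 ≤ t) :
    ∫ ξ, net.embedded ϑ r ψ ξ ∂π -
      Real.exp (-(t * r)) * (∫ ξ, net.embedded ϑ r ψ ξ ∂π - ∫ ξ, ψ ξ ∂π) ≤
      ∫ ξ, net.transition ϑ t ψ ξ ∂π := by
  have h1 := hasSum_uniformization (net.embeddedCLM hϑ hr hle) r t ψ (integralCLM π)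
  simp only [integralCLM_apply, coe_embeddedCLM_pow] at h1
  have h2 : ∫ ξ, net.transition ϑ t ψ ξ ∂π =
      ∫ ξ, expSemigroup (r • (net.embeddedCLM hϑ hr hle - 1)) t ψ ξ ∂π :=
    integral_congr_ae (ae_of_all _ fun ξ => net.transition_eq hϑ hr hle t ψ ξ)
  rw [h2]
  set a := ∫ ξ, ψ ξ ∂π with ha
  set b := ∫ ξ, net.embedded ϑ r ψ ξ ∂π with hb
  -- The minorant replaces every term with `n ≥ 1` by `b` and keeps `a` at `n = 0`, whose Poisson
  -- weight is `exp (-(t * r))`.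
  have h3 := (hasSum_poisson (t * r) b).sub
    (hasSum_ite_eq (0 : ℕ) (Real.exp (-(t * r)) * (b - a)))
  refine hasSum_le (fun n => ?_) h3 h1
  rcases n with _ | n
  · simp [← ha]
    linarith
  · simp only [Nat.add_eq_zero_iff, one_ne_zero, and_false, if_false, sub_zero]
    refine mul_le_mul_of_nonneg_left ?_ (by positivity)
    have := hmono (Nat.succ_le_succ n.zero_le)
    simpa only [Nat.succ_eq_add_one, zero_add, pow_one] using this

/-- Convergence holds from every initial state and `‖ψ‖` dominates, so it holds from any initial
law. -/
lemma IsLimitingDistribution.tendsto_integral_transition (hϑ : 0 ≤ ϑ) {πϑ : Measure net.State}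
    (hπϑ : net.IsLimitingDistribution ϑ πϑ) (π : Measure net.State) [IsProbabilityMeasure π]
    (ψ : net.BddFun) :
    Tendsto (fun t : ℝ => ∫ ξ, net.transition ϑ t ψ ξ ∂π) atTop (𝓝 (∫ ξ, ψ ξ ∂πϑ)) := by
  have h := tendsto_integral_filter_of_dominated_convergence (μ := π) (l := atTop)
    (F := fun (t : ℝ) ξ => net.transition ϑ t ψ ξ) (f := fun _ => ∫ ξ, ψ ξ ∂πϑ) (fun _ => ‖ψ‖)
    (Eventually.of_forall fun t => Measurable.of_discrete.aestronglyMeasurable)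
    ((eventually_ge_atTop 0).mono fun t ht => ae_of_all _ (net.abs_transition_le hϑ ht ψ))
    (integrable_const _) (ae_of_all _ fun ξ => hπϑ.2 ψ ⟨_, ψ.abs_apply_le⟩ ξ)
  simpa using h

end Comparison

end QNetwork

/-! ### The strict inequality -/

open QNetwork in
theorem proposition2 {d N : ℕ} (net : QNetwork d N)
    (F : Set (net.State → ℝ)) (hF : F ⊆ net.increasing)
    (θ ϑ : Fin d → ℝ) (hθ : 0 ≤ θ) (hlt : θ < ϑ)
    (hstable : ϑ ∈ net.stabilityRegion)
    (hmono : net.IsMonotone ϑ F)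
    (φ : net.State → ℝ) (hφ : φ ∈ F) (hbdd : ∃ C : ℝ, ∀ ξ, |φ ξ| ≤ C)
    (hne : ∀ k : Fin d, ∃ ξ : net.State, net.Reachable θ ξ ∧ φ (net.arrive k ξ) ≠ φ ξ)
    (πθ πϑ : MeasureTheory.Measure net.State)
    (hπθ : net.IsLimitingDistribution θ πθ) (hπϑ : net.IsLimitingDistribution ϑ πϑ) :
    0 < ∫ ξ, φ ξ ∂πϑ - ∫ ξ, φ ξ ∂πθ := by
  have := hπθ.1
  have hϑ : 0 ≤ ϑ := hθ.trans hlt.le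
  obtain ⟨r, hle, hinc⟩ := hmono
  obtain ⟨k, hk⟩ := (Pi.lt_def.1 hlt).2
  have hr : 0 < r := by
    refine (Finset.sum_pos' (fun k _ => hϑ k) ⟨k, Finset.mem_univ k, ?_⟩).trans_le
      ((net.sum_le_totalRate ϑ).trans hle)
    exact (hθ k).trans_lt hk
  let ψ : net.BddFun := BddFun.mk φ hbdd
  have hmon : Monotone fun n : ℕ => ∫ ξ, (net.embedded ϑ r ^ n) ψ ξ ∂πθ := by
    refine monotone_nat_of_le_succ fun n => ?_
    have h := hπθ.integral_le_integral_embedded hθ hlt.le hr hle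
      ((net.embeddedCLM hϑ hr hle ^ n) ψ)
      (by rw [coe_embeddedCLM_pow]; exact hinc φ hφ n)
    rw [coe_embeddedCLM_pow] at h
    rwa [pow_succ']
  have hstrict := hπθ.integral_lt_integral_embedded hθ hlt hr hle ψ (hF hφ) hne
  have hexp : Tendsto (fun t : ℝ => Real.exp (-(t * r))) atTop (𝓝 0) :=
    Real.tendsto_exp_neg_atTop_nhds_zero.comp (tendsto_id.atTop_mul_const hr)
  have hlim := (hexp.mul_const
    (∫ ξ, net.embedded ϑ r ψ ξ ∂πθ - ∫ ξ, ψ ξ ∂πθ)).const_sub (∫ ξ, net.embedded ϑ r ψ ξ ∂πθ)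
  rw [zero_mul, sub_zero] at hlim
  -- Letting `t → ∞` keeps only a weak inequality; strictness comes from `hstrict`, which does not
  -- involve `t`.
  have hfin := le_of_tendsto_of_tendsto hlim (hπϑ.tendsto_integral_transition hϑ πθ ψ)
    ((eventually_ge_atTop 0).mono fun t ht => le_integral_transition hϑ hr hle ψ hmon ht)
  exact sub_pos.2 (hstrict.trans_le hfin)

end
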